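/- Let $p(m)$ denote the number of partitions of the integer $m$, with $p(0)=1$ and $p(m)=0$ for $m<0$; let $q(m)$ denote the number of partitions of $m$ into distinct parts (so $q(0)=1$); and let $T_k = k(k+1)/2$ be the $k$-th triangular number. Then for every integer $n\ge 0$, $$\sum_{k=0}^{\infty} (-1)^{T_k}\, p(n-T_k) = \begin{cases} q\left(\frac{n}{2}\right), & \text{if } n \text{ is even},\\ 0, & \text{if } n \text{ is odd,}\end{cases}$$ where the sum has only finitely many nonzero terms. -/

import Mathlib

/-- The `k`-th triangular number `T_k = k (k + 1) / 2` (the division is exact). -/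
def triangularNumber (k : ℕ) : ℕ := k * (k + 1) / 2

/-- Euler's partition function `p`, the number of partitions of `m`, extended by `0` to negative
integers, so that `p (n - T_k)` makes sense for every `k`. -/
def eulerPartitionFunction (m : ℤ) : ℕ :=
  if 0 ≤ m then Fintype.card (Nat.Partition m.toNat) else 0

/-- `q(m)`, the number of partitions of `m` into distinct parts. -/
def distinctPartitionFunction (m : ℕ) : ℕ := (Nat.Partition.distincts m).card

open Finset Filter

section FiniteIdentity

variable {R : Type*} [CommRing R]

/-! Gauss's identity gives `∑ (-X)^{T_k} = ∏ (1 - X^{2i}) / ∏ (1 + X^{2i-1})`. Multiplying by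
Euler's `∑ p(n) X^n = 1 / ∏ (1 - X^i)` and using `1 - X^{2i} = (1 - X^i)(1 + X^i)` leaves `∏ (1 +
X^i) / ∏ (1 + X^{2i-1}) = ∏ (1 + X^{2i})`, the series of `q` at `X^2`; compare coefficients. Gauss's
identity is the limit of Shanks's polynomial identity `prod_mul_sum_triangularNumber`, whose right
side is `∏_{i ≤ n} (1 - x^{2i})` modulo `x^n`. -/

theorem triangularNumber_succ (k : ℕ) :
    triangularNumber (k + 1) = triangularNumber k + (k + 1) := by
  unfold triangularNumber
  rw [show (k + 1) * (k + 1 + 1) = k * (k + 1) + (k + 1) * 2 by ring,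
    Nat.add_mul_div_right _ _ two_pos]

theorem triangularNumber_two_mul (k : ℕ) : triangularNumber (2 * k) = k * (2 * k + 1) := by
  unfold triangularNumber
  rw [show 2 * k * (2 * k + 1) = k * (2 * k + 1) * 2 by ring, Nat.mul_div_cancel _ two_pos]

/-- The partial sums of Shanks's finite form of Gauss's triangular number series, with the
denominators cleared. -/
def shanksSum (x : R) (n m : ℕ) : R :=
  ∑ s ∈ range m, (-1) ^ s * x ^ (s * (2 * n + 1)) *
    ((∏ r ∈ range s, (1 + x ^ (2 * r + 1))) * ∏ r ∈ Ico s n, (1 - x ^ (2 * r + 2)))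

/-- The difference telescopes in the truncation `m`, which is kept apart from `n` for that
induction; `m = n` then yields the recurrence in `n`. -/
theorem shanksSum_succ_sub (x : R) {n m : ℕ} (hm : m ≤ n) :
    shanksSum x (n + 1) m - (1 + x ^ (2 * n + 1)) * shanksSum x n m =
      (-1) ^ m * x ^ (m * (2 * n + 1)) * ((1 - x ^ (2 * m)) *
        ((∏ r ∈ range m, (1 + x ^ (2 * r + 1))) * ∏ r ∈ Ico m n, (1 - x ^ (2 * r + 2)))) := by
  induction m with
  | zero => simp [shanksSum]
  | succ m ih =>
    have ih := ih (by omega)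
    simp only [shanksSum] at ih ⊢
    rw [sum_range_succ, sum_range_succ, prod_range_succ, prod_Ico_succ_top (by omega : m ≤ n)]
    rw [prod_eq_prod_Ico_succ_bot (by omega : m < n)] at ih ⊢
    linear_combination ih

theorem prod_mul_sum_triangularNumber (x : R) (n : ℕ) :
    (∏ r ∈ range n, (1 + x ^ (2 * r + 1))) *
      ∑ k ∈ range (2 * n), (-1) ^ triangularNumber k * x ^ triangularNumber k =
    shanksSum x n n := by
  induction n with
  | zero => simp [shanksSum]
  | succ n ih =>
    have h := shanksSum_succ_sub x (le_refl n)
    have h1 : shanksSum x (n + 1) (n + 1) = shanksSum x (n + 1) n + (-1) ^ n *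
        x ^ (n * (2 * (n + 1) + 1)) *
        ((∏ r ∈ range n, (1 + x ^ (2 * r + 1))) * (1 - x ^ (2 * n + 2))) := by
      simp [shanksSum, sum_range_succ]
    have h2 : (-1 : R) ^ (n * (2 * n + 1)) = (-1) ^ n := by
      rw [pow_mul']; simp [pow_add, pow_mul]
    have h3 : (-1 : R) ^ (n * (2 * n + 1) + (2 * n + 1)) = -(-1) ^ n := by
      rw [pow_add, h2]; simp [pow_add, pow_mul]
    rw [show 2 * (n + 1) = 2 * n + 1 + 1 by ring, sum_range_succ, sum_range_succ,
      triangularNumber_succ, triangularNumber_two_mul, prod_range_succ, h1, h2, h3]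
    simp only [Ico_self, prod_empty] at h
    -- The new terms `k = 2n, 2n + 1` on the left account for the correction in `h` plus the new
    -- Shanks term `s = n`.
    linear_combination (1 + x ^ (2 * n + 1)) * ih - h

/-- The product is the term `s = 0`; every term with `s ≥ 1` carries `x ^ (s * (2 * n + 1))`. -/
theorem shanksSum_eq_prod_add (x : R) (n : ℕ) :
    ∃ y, shanksSum x n n = ∏ r ∈ range n, (1 - x ^ (2 * r + 2)) + x ^ n * y := by
  rcases n.eq_zero_or_pos with rfl | hn
  -- For `n = 0` the sum is empty but the product is `1`.
  · exact ⟨-1, by simp [shanksSum]⟩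
  have h : x ^ n ∣ shanksSum x n n - ∏ r ∈ range n, (1 - x ^ (2 * r + 2)) := by
    rw [shanksSum, range_eq_Ico, sum_eq_sum_Ico_succ_bot hn]
    simp only [zero_mul, pow_zero, one_mul, prod_range_zero, add_sub_cancel_left]
    refine dvd_sum fun s hs ↦ Dvd.dvd.mul_right (Dvd.dvd.mul_left (pow_dvd_pow x ?_) _) _
    have := (mem_Ico.mp hs).1
    nlinarith
  obtain ⟨y, hy⟩ := h
  exact ⟨y, by rw [← hy]; ring⟩

end FiniteIdentity

section Series

open PowerSeries PowerSeries.WithPiTopology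
open scoped Topology

-- With `ℤ` discrete, series converge when each coefficient is eventually constant.
local instance : TopologicalSpace ℤ := ⊥
local instance : DiscreteTopology ℤ := ⟨rfl⟩

theorem tendsto_order_X_pow_of_le {f : ℕ → ℕ} (hf : ∀ k, k ≤ f k) :
    Tendsto (fun k ↦ ((X : ℤ⟦X⟧) ^ f k).order) atTop (𝓝 ⊤) := by
  simp_rw [order_X_pow]
  exact ENat.tendsto_natCast_nhds_top.comp (tendsto_atTop_mono hf tendsto_id)

theorem multipliable_one_add_X_pow_of_le {f : ℕ → ℕ} (hf : ∀ k, k ≤ f k) :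
    Multipliable fun k ↦ (1 : ℤ⟦X⟧) + X ^ f k :=
  multipliable_one_add_of_tendsto_order_atTop_nhds_top ℤ (tendsto_order_X_pow_of_le hf)

theorem multipliable_one_sub_X_pow_of_le {f : ℕ → ℕ} (hf : ∀ k, k ≤ f k) :
    Multipliable fun k ↦ (1 : ℤ⟦X⟧) - X ^ f k := by
  simp_rw [sub_eq_add_neg]
  refine multipliable_one_add_of_tendsto_order_atTop_nhds_top ℤ ?_
  simp_rw [order_neg]
  exact tendsto_order_X_pow_of_le hf

theorem le_triangularNumber (k : ℕ) : k ≤ triangularNumber k := by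
  induction k with
  | zero => simp
  | succ k ih => rw [triangularNumber_succ]; omega

theorem summable_triangularNumber :
    Summable fun k ↦ (-1 : ℤ⟦X⟧) ^ triangularNumber k * X ^ triangularNumber k := by
  refine summable_of_tendsto_order_atTop_nhds_top ℤ ?_
  have h (k : ℕ) : ((-1 : ℤ⟦X⟧) ^ triangularNumber k * X ^ triangularNumber k).order =
      ((X : ℤ⟦X⟧) ^ triangularNumber k).order := by
    rcases neg_one_pow_eq_or ℤ⟦X⟧ (triangularNumber k) with h | h <;> simp [h]
  simp_rw [h]
  exact tendsto_order_X_pow_of_le le_triangularNumber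

/-- Gauss's identity for the alternating triangular number series. -/
theorem tprod_mul_tsum_triangularNumber :
    (∏' r : ℕ, (1 + (X : ℤ⟦X⟧) ^ (2 * r + 1))) *
      ∑' k, (-1 : ℤ⟦X⟧) ^ triangularNumber k * X ^ triangularNumber k =
    ∏' r : ℕ, (1 - (X : ℤ⟦X⟧) ^ (2 * r + 2)) := by
  have hA := (multipliable_one_add_X_pow_of_le
    (f := fun r ↦ 2 * r + 1) (by intro k; omega)).hasProd.tendsto_prod_nat
  have hB := (multipliable_one_sub_X_pow_of_le
    (f := fun r ↦ 2 * r + 2) (by intro k; omega)).hasProd.tendsto_prod_nat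
  -- The finite identity involves only partial sums of even length `2 * n`.
  have hS := summable_triangularNumber.hasSum.tendsto_sum_nat.comp
    (tendsto_id.const_mul_atTop' (two_pos : 0 < 2))
  refine tendsto_nhds_unique (hA.mul hS) ?_
  choose y hy using shanksSum_eq_prod_add (X : ℤ⟦X⟧)
  have hy0 : Tendsto (fun n ↦ (X : ℤ⟦X⟧) ^ n * y n) atTop (𝓝 0) := by
    rw [tendsto_iff_coeff_tendsto]
    refine fun d ↦ tendsto_atTop_of_eventually_const (i₀ := d + 1) fun i hi ↦ ?_
    rw [map_zero, coeff_X_pow_mul', if_neg (by omega)]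
  have := hB.add hy0
  rw [add_zero] at this
  refine this.congr fun n ↦ ?_
  simp only [← hy, ← prod_mul_sum_triangularNumber, Function.comp_apply, id]

theorem mk_card_partition_mul_tprod :
    (PowerSeries.mk fun n ↦ (Fintype.card (Nat.Partition n) : ℤ)) *
      ∏' i : ℕ, (1 - (X : ℤ⟦X⟧) ^ (i + 1)) = 1 := by
  have h := Nat.Partition.hasProd_powerSeriesMk_card_restricted ℤ (fun _ ↦ True)
  have hP := h.mul (multipliable_one_sub_X_pow ℤ).hasProd
  simp only [if_true, pow_mul, Nat.Partition.restricted] at hP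
  -- Each Euler factor is a geometric series, so the two products cancel factor by factor.
  have h1 (i : ℕ) : (∑' j : ℕ, ((X : ℤ⟦X⟧) ^ (i + 1)) ^ j) * (1 - X ^ (i + 1)) = 1 :=
    tsum_pow_mul_one_sub_of_constantCoeff_eq_zero (by simp)
  simp only [h1] at hP
  simpa using hP.unique hasProd_one

theorem mk_card_distincts_eq_tprod :
    (PowerSeries.mk fun n ↦ (distinctPartitionFunction n : ℤ)) =
      ∏' i : ℕ, (1 + (X : ℤ⟦X⟧) ^ (i + 1)) := by
  have h := Nat.Partition.powerSeriesMk_card_countRestricted_eq_tprod ℤ Nat.two_pos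
  simp only [Nat.Partition.countRestricted_two] at h
  exact h.trans (tprod_congr fun i ↦ by simp [sum_range_succ])

theorem continuous_expand {p : ℕ} (hp : p ≠ 0) :
    Continuous (PowerSeries.expand p hp : ℤ⟦X⟧ →ₐ[ℤ] ℤ⟦X⟧) := by
  rw [continuous_iff_continuousAt]
  intro f
  rw [ContinuousAt, tendsto_iff_coeff_tendsto]
  intro d
  simp_rw [coeff_expand]
  split_ifs
  · exact (continuous_coeff ℤ _).tendsto f
  · exact tendsto_const_nhds

theorem expand_mk_card_distincts_eq_tprod :
    PowerSeries.expand 2 two_ne_zero (PowerSeries.mk fun n ↦ (distinctPartitionFunction n : ℤ)) =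
      ∏' r : ℕ, (1 + (X : ℤ⟦X⟧) ^ (2 * r + 2)) := by
  rw [mk_card_distincts_eq_tprod, Multipliable.map_tprod
    (multipliable_one_add_X_pow_of_le (by intro k; omega)) _ (continuous_expand two_ne_zero)]
  simp [PowerSeries.expand_X, ← pow_mul, mul_add]

theorem tprod_odd_mul_tprod_even :
    (∏' r : ℕ, (1 + (X : ℤ⟦X⟧) ^ (2 * r + 1))) * ∏' r : ℕ, (1 + (X : ℤ⟦X⟧) ^ (2 * r + 2)) =
      ∏' i : ℕ, (1 + (X : ℤ⟦X⟧) ^ (i + 1)) :=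
  tprod_even_mul_odd (f := fun i ↦ 1 + (X : ℤ⟦X⟧) ^ (i + 1))
    (multipliable_one_add_X_pow_of_le (by intro k; omega))
    (multipliable_one_add_X_pow_of_le (by intro k; omega))

theorem tprod_one_add_mul_tprod_one_sub :
    (∏' i : ℕ, (1 + (X : ℤ⟦X⟧) ^ (i + 1))) * ∏' i : ℕ, (1 - (X : ℤ⟦X⟧) ^ (i + 1)) =
      ∏' r : ℕ, (1 - (X : ℤ⟦X⟧) ^ (2 * r + 2)) := by
  rw [← (multipliable_one_add_X_pow_of_le (by intro k; omega)).tprod_mul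
    (multipliable_one_sub_X_pow ℤ)]
  exact tprod_congr fun i ↦ by ring

/-- The constant coefficient is `1`. This allows cancelling the product in the domain `ℤ⟦X⟧` instead
of dividing by it. -/
theorem tprod_one_add_X_pow_odd_ne_zero :
    ∏' r : ℕ, (1 + (X : ℤ⟦X⟧) ^ (2 * r + 1)) ≠ 0 := by
  intro h
  have h1 := (multipliable_one_add_X_pow_of_le
    (f := fun r ↦ 2 * r + 1) (by intro k; omega)).map_tprod
    (constantCoeff (R := ℤ)) (continuous_constantCoeff ℤ)
  rw [h] at h1
  simp at h1

theorem tsum_triangularNumber_mul_mk_card_partition :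
    (∑' k, (-1 : ℤ⟦X⟧) ^ triangularNumber k * X ^ triangularNumber k) *
      (PowerSeries.mk fun n ↦ (Fintype.card (Nat.Partition n) : ℤ)) =
    PowerSeries.expand 2 two_ne_zero
      (PowerSeries.mk fun n ↦ (distinctPartitionFunction n : ℤ)) := by
  apply mul_left_cancel₀ tprod_one_add_X_pow_odd_ne_zero
  rw [← mul_assoc, tprod_mul_tsum_triangularNumber, expand_mk_card_distincts_eq_tprod,
    tprod_odd_mul_tprod_even, ← tprod_one_add_mul_tprod_one_sub, mul_assoc,
    mul_comm (∏' i : ℕ, (1 - (X : ℤ⟦X⟧) ^ (i + 1))), mk_card_partition_mul_tprod, mul_one]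

theorem coeff_triangularNumber_mul_mk_card_partition (n k : ℕ) :
    coeff n ((-1 : ℤ⟦X⟧) ^ triangularNumber k * X ^ triangularNumber k *
      (PowerSeries.mk fun n ↦ (Fintype.card (Nat.Partition n) : ℤ))) =
    (-1 : ℤ) ^ triangularNumber k *
      (eulerPartitionFunction ((n : ℤ) - (triangularNumber k : ℤ)) : ℤ) := by
  have h : (-1 : ℤ⟦X⟧) ^ triangularNumber k = C ((-1 : ℤ) ^ triangularNumber k) := by simp
  rw [h, mul_assoc, coeff_C_mul, coeff_X_pow_mul', eulerPartitionFunction]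
  by_cases hk : triangularNumber k ≤ n
  · rw [if_pos hk, if_pos (by omega), coeff_mk,
      show ((n : ℤ) - (triangularNumber k : ℤ)).toNat = n - triangularNumber k by omega]
  · rw [if_neg hk, if_neg (by omega), Nat.cast_zero]

theorem hasSum_triangularNumber_mul_eulerPartitionFunction (n : ℕ) :
    HasSum
      (fun k : ℕ => (-1 : ℤ) ^ triangularNumber k *
        (eulerPartitionFunction ((n : ℤ) - (triangularNumber k : ℤ)) : ℤ))
      (if Even n then (distinctPartitionFunction (n / 2) : ℤ) else 0) := by
  have h := (summable_triangularNumber.hasSum.mul_right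
    (PowerSeries.mk fun n ↦ (Fintype.card (Nat.Partition n) : ℤ))).map
    (coeff (R := ℤ) n) (continuous_coeff ℤ n)
  rw [tsum_triangularNumber_mul_mk_card_partition, coeff_expand] at h
  simpa only [Function.comp_def, coeff_triangularNumber_mul_mk_card_partition, coeff_mk,
    ← even_iff_two_dvd] using h

end Series

theorem mainTheorem6 (n : ℕ) :
    HasSum
      (fun k : ℕ => (-1 : ℤ) ^ triangularNumber k *
        (eulerPartitionFunction ((n : ℤ) - (triangularNumber k : ℤ)) : ℤ))
      (if Even n then (distinctPartitionFunction (n / 2) : ℤ) else 0) := by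
  convert hasSum_triangularNumber_mul_eulerPartitionFunction n
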